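/- Let $D\subseteq\mathbb{R}^n$ be open with $0\in D$, let $F\in C^2(D;\mathbb{R}^n)$ with $F(0)=0$, and suppose that $\dot x=F(x)$ induces a flow $S^t:D\to D$, $t\in\mathbb{R}$. Put $A=DF(0)$ and assume that every eigenvalue of $A$ has non-zero real part. Let $h:\mathcal N\to\mathcal V$ be a local linearization at $0$: a homeomorphism (for instance a $C^1$ diffeomorphism) of an open neighbourhood $\mathcal N\subseteq D$ of $0$ onto an open set $\mathcal V\subseteq\mathbb{R}^n$ such that for each $x\in\mathcal N$ there is an open interval $I(x)\ni 0$ with $S^t x\in\mathcal N$ and $h(S^t x)=e^{tA}h(x)$ for all $t\in I(x)$. Let $V$ be an invertible complex matrix such that $J=V^{-1}AV$ is in Jordan normal form, with diagonal entries $\lambda_1,\dots,\lambda_n$, and let $k=V^{-1}h$. Call an open connected set $N\ni 0$ admissible if $\overline N\subset\mathcal N$ and, for every $y\in h(\overline N)$, the set of times $\{t\in\mathbb{R}: e^{tA}y\in h(\overline N)\}$ is an interval. Given such an $N$, let $P$ be the set of $z\in D$ with $S^tz\in\overline N$ for some $t\in\mathbb{R}$. For $z\in P$ let $t(z)$ be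 the least $t\ge 0$ with $S^tz\in\overline N$ if there is such a $t\ge0$, and otherwise the greatest $t<0$ with $S^tz\in\overline N$. Let $s=(s_1,\dots,s_n):P\to\mathbb{C}^n$ be the extension of $k$ along the flow, $$s(z)=e^{-t(z)J}\,k(S^{t(z)}z)\qquad(z\in P)$$ (so $s_i(z)=e^{-\lambda_i t(z)}k_i(S^{t(z)}z)$ when $J$ is diagonal), or, alternatively, let $s=(s_1,\dots,s_n)$ be any family of (generalized) open eigenfunctions of the Koopman operator on $P$ with $s=k$ on $\overline N$; that is, $s(S^\tau x)=e^{\tau J}s(x)$ for $x\in P$ and all $\tau$ in any open interval containing $0$ on which the trajectory of $x$ stays in $P$. Let $W^s_P$ be the principal part of the stable manifold: the set of $z\in P$ with $S^tz\to0$ as $t\to+\infty$ for which $x=S^{t(z)}z$ lies in the local stable manifold, i.e. $S^tx\in\overline N$ for all $t\ge0$ and $S^tx\to0$ as $t\to+\infty$. Let $W^u_P$ be defined in the same way with $t\le 0$ and $t\to-\infty$. Then every neighbourhood of $0$ contains an admissible $N$, and for every admissible $N$ and every such $s$ $$\{x\in P: s_i(x)=0\text{ for all } i \text{ with } \operatorname{Re}\lambda_i>0\}=W^s_P,\qquad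 \{x\in P: s_i(x)=0\text{ for all } i \text{ with } \operatorname{Re}\lambda_i<0\}=W^u_P .$$ -/

import Mathlib

open Filter Topology

noncomputable section

namespace Koopman

/-- The Euclidean state space `ℝⁿ`. -/
abbrev E (n : ℕ) : Type := EuclideanSpace ℝ (Fin n)

/-- `S : D × ℝ → D` is the flow on `D` of the autonomous system `x' = F x`: for `x ∈ D` the curve
`t ↦ S t x` is the solution through `x`, it is defined for all times and stays in `D`. -/
def IsFlowOn {n : ℕ} (F : E n → E n) (D : Set (E n)) (S : ℝ → E n → E n) : Prop :=
  ∀ x ∈ D, S 0 x = x ∧ ∀ t : ℝ, S t x ∈ D ∧ HasDerivAt (fun τ => S τ x) (F (S t x)) t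

/-- The matrix of `DF` at the origin, with complex entries. -/
def jacobian {n : ℕ} (F : E n → E n) : Matrix (Fin n) (Fin n) ℂ :=
  Matrix.of fun i j => ((fderiv ℝ F 0 (EuclideanSpace.single j 1) i : ℝ) : ℂ)

/-- All eigenvalues of `DF` at the origin have non-zero real part. -/
def IsHyperbolic {n : ℕ} (F : E n → E n) : Prop :=
  ∀ μ ∈ spectrum ℂ (jacobian F), μ.re ≠ 0

/-- Complex Jordan normal form: the only possibly non-zero entries are the diagonal ones
and entries `1` directly above the diagonal, between equal diagonal entries. -/
def IsJordan {n : ℕ} (J : Matrix (Fin n) (Fin n) ℂ) : Prop :=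
  ∀ i j : Fin n, i ≠ j → J i j ≠ 0 → (j : ℕ) = i + 1 ∧ J i j = 1 ∧ J i i = J j j

/-- The linearized flow `e^{tA}`, with `A = DF` at the origin. -/
def linFlow {n : ℕ} (F : E n → E n) (t : ℝ) : E n →L[ℝ] E n :=
  NormedSpace.exp (t • fderiv ℝ F 0)

/-- `h` is a local linearization of the flow at the origin, as in the Hartman-Grobman theorem:
a homeomorphism of an open neighbourhood `h.source ⊆ D` of the origin onto an open set
`h.target`, such that every `x ∈ h.source` has an open interval `I` of times around `0`
on which `h (S t x) = e^{tA} (h x)`. A `C¹` diffeomorphism is a special case. -/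
structure IsLinearization {n : ℕ} (F : E n → E n) (D : Set (E n)) (S : ℝ → E n → E n)
    (h : OpenPartialHomeomorph (E n) (E n)) : Prop where
  zero_mem : (0 : E n) ∈ h.source
  source_subset : h.source ⊆ D
  conj : ∀ x ∈ h.source, ∃ I : Set ℝ, IsOpen I ∧ I.OrdConnected ∧ (0 : ℝ) ∈ I ∧
    ∀ t ∈ I, S t x ∈ h.source ∧ h (S t x) = linFlow F t (h x)

/-- `N` is an open connected neighbourhood of the origin whose closure lies in the domain of
`h` and has an image that every trajectory of the linearized system meets in a (possibly
empty, possibly infinite) interval of times. -/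
structure IsAdmissible {n : ℕ} (F : E n → E n) (h : OpenPartialHomeomorph (E n) (E n))
    (N : Set (E n)) : Prop where
  isOpen : IsOpen N
  isConnected : IsConnected N
  zero_mem : (0 : E n) ∈ N
  closure_subset : closure N ⊆ h.source
  ordConnected : ∀ y ∈ h '' closure N, {t : ℝ | linFlow F t y ∈ h '' closure N}.OrdConnected

/-- The local functions `k = V⁻¹ h`. -/
def localEigen {n : ℕ} (h : OpenPartialHomeomorph (E n) (E n)) (V : Matrix (Fin n) (Fin n) ℂ)
    (x : E n) : Fin n → ℂ :=
  V⁻¹.mulVec fun i => ((h x i : ℝ) : ℂ)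

/-- The set `P` of points of the state space `D` whose trajectory, forward or backward in time,
meets the closure of `N`. -/
def domainP {n : ℕ} (S : ℝ → E n → E n) (D N : Set (E n)) : Set (E n) :=
  {z | z ∈ D ∧ ∃ t : ℝ, S t z ∈ closure N}

open Classical in
/-- The time `t(z)` to enter the closure of `N`: the first time `t ≥ 0` with `S t z ∈ closure N`
if there is one (so `t(z) = 0` for `z ∈ closure N`), and otherwise the last time `t < 0` with
`S t z ∈ closure N`. It is meant for `z` in `domainP S D N`, where these times exist. -/
def entryTime {n : ℕ} (S : ℝ → E n → E n) (N : Set (E n)) (z : E n) : ℝ :=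
  if ∃ t : ℝ, 0 ≤ t ∧ S t z ∈ closure N then sInf {t : ℝ | 0 ≤ t ∧ S t z ∈ closure N}
  else sSup {t : ℝ | t ≤ 0 ∧ S t z ∈ closure N}

/-- On `P`, `s` is the extension of `k` along the flow,
`s z = e^{-t(z) J} k (S^{t(z)} z)`. For diagonal `J` this is
`s_i z = e^{-λ_i t(z)} k_i (S^{t(z)} z)`. -/
def IsFlowExtension {n : ℕ} (S : ℝ → E n → E n) (D N : Set (E n))
    (J : Matrix (Fin n) (Fin n) ℂ) (k s : E n → Fin n → ℂ) : Prop :=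
  ∀ z ∈ domainP S D N,
    s z = (NormedSpace.exp (((-entryTime S N z : ℝ) : ℂ) • J)).mulVec (k (S (entryTime S N z) z))

/-- The components of `s` are (generalized) open eigenfunctions of the Koopman family on `P`,
associated with the diagonal entries (eigenvalues) of the Jordan matrix `J`: along every piece of
trajectory that stays in `P` one has `s ∘ S^τ = e^{τ J} s`, which is the solution of `s' = J s`.
For diagonal `J` this is `s_i (S^τ x) = e^{λ_i τ} s_i x`. -/
def IsOpenEigenfamily {n : ℕ} (S : ℝ → E n → E n) (P : Set (E n))
    (J : Matrix (Fin n) (Fin n) ℂ) (s : E n → Fin n → ℂ) : Prop :=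
  ∀ x ∈ P, ∀ I : Set ℝ, IsOpen I → I.OrdConnected → (0 : ℝ) ∈ I → (∀ τ ∈ I, S τ x ∈ P) →
    ∀ τ ∈ I, s (S τ x) = (NormedSpace.exp ((τ : ℂ) • J)).mulVec (s x)

/-- The stable manifold of the origin. -/
def stableManifold {n : ℕ} (S : ℝ → E n → E n) (D : Set (E n)) : Set (E n) :=
  {z | z ∈ D ∧ Tendsto (fun t => S t z) atTop (𝓝 0)}

/-- The unstable manifold of the origin. -/
def unstableManifold {n : ℕ} (S : ℝ → E n → E n) (D : Set (E n)) : Set (E n) :=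
  {z | z ∈ D ∧ Tendsto (fun t => S t z) atBot (𝓝 0)}

/-- The local stable manifold of the origin in `K`. -/
def localStable {n : ℕ} (S : ℝ → E n → E n) (K : Set (E n)) : Set (E n) :=
  {x | (∀ t : ℝ, 0 ≤ t → S t x ∈ K) ∧ Tendsto (fun t => S t x) atTop (𝓝 0)}

/-- The local unstable manifold of the origin in `K`. -/
def localUnstable {n : ℕ} (S : ℝ → E n → E n) (K : Set (E n)) : Set (E n) :=
  {x | (∀ t : ℝ, t ≤ 0 → S t x ∈ K) ∧ Tendsto (fun t => S t x) atBot (𝓝 0)}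

/-- The principal part `W^s_P` of the stable manifold. -/
def principalStable {n : ℕ} (S : ℝ → E n → E n) (D N : Set (E n)) : Set (E n) :=
  {z | z ∈ domainP S D N ∧ z ∈ stableManifold S D ∧
    S (entryTime S N z) z ∈ localStable S (closure N)}

/-- The principal part `W^u_P` of the unstable manifold. -/
def principalUnstable {n : ℕ} (S : ℝ → E n → E n) (D N : Set (E n)) : Set (E n) :=
  {z | z ∈ domainP S D N ∧ z ∈ unstableManifold S D ∧
    S (entryTime S N z) z ∈ localUnstable S (closure N)}

end Koopman

end

/-!
In the coordinates `z = V⁻¹ h`, the flow near the origin becomes `z' = J z`. Weighting the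
coordinates by powers of a large `b` makes the part of `J` above the diagonal negligible, so that
the weighted square norm of the stable coordinates (`Re λ_i < 0`) decreases along every solution,
and that of the unstable ones decreases backward in time. Consequently a solution of the linear
system tends to `0` forward in time if and only if its unstable coordinates vanish, and the small
sublevel sets of the larger of the two energies meet every solution in an interval of times: pulled
back by `h`, they are the admissible neighbourhoods.

If `N` is admissible and the linear solution through `h x`, with `x` in the closure of `N`, tends to
`0`, then it ends up in the image of `N`, hence never leaves the image of the closure at positive
times. The conjugacy, which is only given for short times, therefore propagates along the whole half
trajectory. So the local stable manifold is the common zero set of the unstable components of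
`k = V⁻¹ h`. As `e^{tJ}` commutes with the projection onto the components with a given sign of
`Re λ_i`, the zeros of `s` at `z` are those of `k` at the point where the trajectory of `z` enters
the closure of `N`. The unstable manifold is the stable one of the reversed flow, which `h`
linearizes with `-J` in place of `J`.
-/

namespace Koopman

open Matrix

variable {n : ℕ}

section Energy

/-- An upper triangular matrix that couples only coordinates whose diagonal entries have real
parts of the same sign. This is all that the argument needs of a Jordan matrix, and it says that
`z' = M z` splits into a stable, a central and an unstable triangular system. -/
structure IsTriangularSplit (M : Matrix (Fin n) (Fin n) ℂ) : Prop where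
  isUpperTriangular : M.IsUpperTriangular
  sign_eq : ∀ i j, M i j ≠ 0 → SignType.sign (M i i).re = SignType.sign (M j j).re

variable {M : Matrix (Fin n) (Fin n) ℂ} {b : ℝ}

theorem IsJordan.isTriangularSplit (hM : IsJordan M) : IsTriangularSplit M where
  isUpperTriangular i j hji := by
    by_contra hne
    have hsucc := (hM i j (ne_of_gt hji) hne).1
    have hlt : (j : ℕ) < i := hji
    omega
  sign_eq i j hne := by
    rcases eq_or_ne i j with rfl | hij
    · rfl
    · rw [(hM i j hij hne).2.2]

theorem IsTriangularSplit.neg (hM : IsTriangularSplit M) : IsTriangularSplit (-M) where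
  isUpperTriangular := Matrix.BlockTriangular.neg hM.isUpperTriangular
  sign_eq i j hne := by
    change SignType.sign (-(M i i).re) = SignType.sign (-(M j j).re)
    rw [Left.sign_neg, Left.sign_neg, hM.sign_eq i j (neg_ne_zero.1 hne)]

/-- The coordinates in which `z' = M z` decays, for `M` triangular. -/
noncomputable def stableIndices (M : Matrix (Fin n) (Fin n) ℂ) : Finset (Fin n) :=
  {i | (M i i).re < 0}

theorem mem_stableIndices {i : Fin n} : i ∈ stableIndices M ↔ (M i i).re < 0 := by
  simp [stableIndices]

/-- A Lyapunov function for the stable coordinates of `z' = M z`. The weights `b ^ i` make the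
entries of `M` above the diagonal small, since rescaling `z i` by `b ^ i` divides `M i j` by
`b ^ (j - i)`. -/
noncomputable def stableEnergy (M : Matrix (Fin n) (Fin n) ℂ) (b : ℝ) (z : Fin n → ℂ) : ℝ :=
  ∑ i ∈ stableIndices M, (b ^ (i : ℕ) * ‖z i‖) ^ 2

theorem stableEnergy_nonneg (z : Fin n → ℂ) : 0 ≤ stableEnergy M b z :=
  Finset.sum_nonneg fun _ _ => sq_nonneg _

theorem stableEnergy_zero : stableEnergy M b 0 = 0 := by simp [stableEnergy]

theorem stableEnergy_smul (r : ℝ) (z : Fin n → ℂ) :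
    stableEnergy M b (r • z) = r ^ 2 * stableEnergy M b z := by
  simp only [stableEnergy, Finset.mul_sum, Pi.smul_apply, norm_smul, mul_pow, Real.norm_eq_abs,
    sq_abs]
  exact Finset.sum_congr rfl fun _ _ => by ring

theorem continuous_stableEnergy : Continuous (stableEnergy M b) := by
  unfold stableEnergy; fun_prop

theorem norm_sq_le_stableEnergy (hb : 1 ≤ b) (z : Fin n → ℂ) {i : Fin n} (hi : (M i i).re < 0) :
    ‖z i‖ ^ 2 ≤ stableEnergy M b z := by
  calc ‖z i‖ ^ 2 ≤ (b ^ (i : ℕ) * ‖z i‖) ^ 2 := by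
        gcongr
        exact le_mul_of_one_le_left (norm_nonneg _) (one_le_pow₀ hb)
    _ ≤ stableEnergy M b z :=
      Finset.single_le_sum (f := fun i : Fin n => (b ^ (i : ℕ) * ‖z i‖) ^ 2)
        (fun _ _ => sq_nonneg _) (mem_stableIndices.2 hi)

/-- The weight `b` is large enough for `stableEnergy M b` to be a strict Lyapunov function:
the left-hand side below is its derivative along `z' = M z`. -/
structure IsLyapunovWeight (M : Matrix (Fin n) (Fin n) ℂ) (b : ℝ) : Prop where
  one_le : 1 ≤ b
  dissipative : ∃ a > 0, ∀ z : Fin n → ℂ,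
    ∑ i ∈ stableIndices M, (b ^ (i : ℕ)) ^ 2 * (2 * inner ℝ (z i) ((M *ᵥ z) i)) ≤
      -a * stableEnergy M b z

theorem inner_mul_self_left (w v : ℂ) : inner ℝ v (w * v) = w.re * ‖v‖ ^ 2 := by
  rw [Complex.inner, mul_assoc, Complex.mul_conj, Complex.re_mul_ofReal, Complex.normSq_eq_norm_sq]

theorem IsTriangularSplit.weighted_inner_entry_le (hM : IsTriangularSplit M) {a C : ℝ}
    (hb : 1 ≤ b) (hC : ∀ i j, ‖M i j‖ ≤ C) (z : Fin n → ℂ) {i j : Fin n} (ha : (M i i).re ≤ -a) :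
    (b ^ (i : ℕ)) ^ 2 * inner ℝ (z i) (M i j * z j) ≤
      (if i = j then -a * (b ^ (i : ℕ) * ‖z i‖) ^ 2 else 0) +
        C / b * ((b ^ (i : ℕ) * ‖z i‖) * (b ^ (j : ℕ) * ‖z j‖)) := by
  have hb0 : 0 < b := one_pos.trans_le hb
  have hC0 : 0 ≤ C := (norm_nonneg _).trans (hC i j)
  rcases lt_trichotomy i j with hij | rfl | hji
  · have hpow : b ^ (i : ℕ) ≤ b ^ (j : ℕ) / b := by
      rw [le_div_iff₀ hb0, ← pow_succ]
      exact pow_le_pow_right₀ hb hij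
    have hinner : inner ℝ (z i) (M i j * z j) ≤ C * (‖z i‖ * ‖z j‖) := by
      refine (real_inner_le_norm _ _).trans ?_
      rw [norm_mul, mul_left_comm]
      gcongr
      exact hC i j
    rw [if_neg hij.ne, zero_add]
    calc (b ^ (i : ℕ)) ^ 2 * inner ℝ (z i) (M i j * z j)
        ≤ b ^ (i : ℕ) * b ^ (i : ℕ) * (C * (‖z i‖ * ‖z j‖)) := by rw [← sq]; gcongr
      _ ≤ b ^ (i : ℕ) * (b ^ (j : ℕ) / b) * (C * (‖z i‖ * ‖z j‖)) := by gcongr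
      _ = C / b * ((b ^ (i : ℕ) * ‖z i‖) * (b ^ (j : ℕ) * ‖z j‖)) := by ring
  · rw [if_pos rfl, inner_mul_self_left]
    calc (b ^ (i : ℕ)) ^ 2 * ((M i i).re * ‖z i‖ ^ 2)
        ≤ (b ^ (i : ℕ)) ^ 2 * (-a * ‖z i‖ ^ 2) := by gcongr
      _ = -a * (b ^ (i : ℕ) * ‖z i‖) ^ 2 := by ring
      _ ≤ _ := le_add_of_nonneg_right (by positivity)
  · rw [if_neg hji.ne', hM.isUpperTriangular hji, zero_mul, inner_zero_right, mul_zero, zero_add]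
    positivity

theorem IsTriangularSplit.mulVec_apply_eq_sum_stableIndices (hM : IsTriangularSplit M)
    (z : Fin n → ℂ) {i : Fin n} (hi : i ∈ stableIndices M) :
    (M *ᵥ z) i = ∑ j ∈ stableIndices M, M i j * z j := by
  rw [mulVec, dotProduct]
  refine (Finset.sum_subset (Finset.subset_univ _) fun j _ hj => ?_).symm
  suffices h0 : M i j = 0 by rw [h0, zero_mul]
  by_contra hne
  rw [mem_stableIndices] at hi hj
  exact hj (sign_eq_neg_one_iff.1 ((hM.sign_eq i j hne).symm.trans (sign_neg hi)))

theorem IsTriangularSplit.sum_weighted_inner_le (hM : IsTriangularSplit M) {a C : ℝ}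
    (hb : 1 ≤ b) (hC0 : 0 ≤ C) (hC : ∀ i j, ‖M i j‖ ≤ C)
    (ha : ∀ i ∈ stableIndices M, (M i i).re ≤ -a) (z : Fin n → ℂ) :
    ∑ i ∈ stableIndices M, (b ^ (i : ℕ)) ^ 2 * inner ℝ (z i) ((M *ᵥ z) i) ≤
      (-a + C / b * n) * stableEnergy M b z := by
  set I := stableIndices M
  set u : Fin n → ℝ := fun i => b ^ (i : ℕ) * ‖z i‖
  have : 0 < b := one_pos.trans_le hb
  have hrow : ∀ i ∈ I, (b ^ (i : ℕ)) ^ 2 * inner ℝ (z i) ((M *ᵥ z) i) ≤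
      -a * u i ^ 2 + C / b * (u i * ∑ j ∈ I, u j) := fun i hi => by
    rw [hM.mulVec_apply_eq_sum_stableIndices z hi, inner_sum, Finset.mul_sum]
    refine (Finset.sum_le_sum fun j _ => hM.weighted_inner_entry_le hb hC z (ha i hi)).trans_eq ?_
    rw [Finset.sum_add_distrib, Finset.sum_ite_eq, if_pos hi, Finset.mul_sum, Finset.mul_sum]
  have hsq : (∑ i ∈ I, u i) ^ 2 ≤ n * ∑ i ∈ I, u i ^ 2 := by
    refine sq_sum_le_card_mul_sum_sq.trans ?_
    gcongr
    simpa only [Fintype.card_fin] using I.card_le_univ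
  calc ∑ i ∈ I, (b ^ (i : ℕ)) ^ 2 * inner ℝ (z i) ((M *ᵥ z) i)
      ≤ ∑ i ∈ I, (-a * u i ^ 2 + C / b * (u i * ∑ j ∈ I, u j)) := Finset.sum_le_sum hrow
    _ = -a * ∑ i ∈ I, u i ^ 2 + C / b * (∑ i ∈ I, u i) ^ 2 := by
      rw [Finset.sum_add_distrib, ← Finset.mul_sum, ← Finset.mul_sum, ← Finset.sum_mul, sq]
    _ ≤ -a * ∑ i ∈ I, u i ^ 2 + C / b * (n * ∑ i ∈ I, u i ^ 2) := by gcongr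
    _ = (-a + C / b * n) * stableEnergy M b z := by rw [stableEnergy]; ring

theorem exists_pos_forall_re_le_neg (M : Matrix (Fin n) (Fin n) ℂ) :
    ∃ a > 0, ∀ i ∈ stableIndices M, (M i i).re ≤ -a := by
  have hev : ∀ᶠ a : ℝ in 𝓝[>] 0, ∀ i ∈ stableIndices M, (M i i).re ≤ -a := by
    refine (Finset.eventually_all _).2 fun i hi => nhdsWithin_le_nhds ?_
    filter_upwards [eventually_le_nhds (neg_pos.2 (mem_stableIndices.1 hi))] with a ha
    exact le_neg_of_le_neg ha
  obtain ⟨a, hle, ha⟩ := (hev.and eventually_mem_nhdsWithin).exists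
  exact ⟨a, ha, hle⟩

theorem IsTriangularSplit.exists_isLyapunovWeight (hM : IsTriangularSplit M) :
    ∃ b, IsLyapunovWeight M b := by
  obtain ⟨a, ha, hre⟩ := exists_pos_forall_re_le_neg M
  set C := ∑ i, ∑ j, ‖M i j‖
  have hC : ∀ i j, ‖M i j‖ ≤ C := fun i j =>
    (Finset.single_le_sum (f := fun j => ‖M i j‖) (fun _ _ => norm_nonneg _)
      (Finset.mem_univ j)).trans
    (Finset.single_le_sum (f := fun i => ∑ j, ‖M i j‖)
      (fun _ _ => Finset.sum_nonneg fun _ _ => norm_nonneg _) (Finset.mem_univ i))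
  have hC0 : 0 ≤ C := by positivity
  have hb : 1 ≤ max 1 (2 * (C * n) / a) := le_max_left _ _
  refine ⟨max 1 (2 * (C * n) / a), hb, a, ha, fun z => ?_⟩
  set b := max 1 (2 * (C * n) / a)
  have hsmall : C / b * n ≤ a / 2 := by
    have hle : 2 * (C * n) / a ≤ b := le_max_right _ _
    rw [div_le_iff₀ ha] at hle
    rw [div_mul_eq_mul_div, div_le_iff₀ (one_pos.trans_le hb)]
    linarith
  calc ∑ i ∈ stableIndices M, (b ^ (i : ℕ)) ^ 2 * (2 * inner ℝ (z i) ((M *ᵥ z) i))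
      = 2 * ∑ i ∈ stableIndices M, (b ^ (i : ℕ)) ^ 2 * inner ℝ (z i) ((M *ᵥ z) i) := by
        rw [Finset.mul_sum]
        exact Finset.sum_congr rfl fun _ _ => mul_left_comm _ _ _
    _ ≤ 2 * ((-a + C / b * n) * stableEnergy M b z) := by
        gcongr
        exact hM.sum_weighted_inner_le hb hC0 hC hre z
    _ ≤ 2 * ((-a + a / 2) * stableEnergy M b z) := by
        have := stableEnergy_nonneg (M := M) (b := b) z
        gcongr
    _ = -a * stableEnergy M b z := by ring

end Energy

section LinearSystem

variable {M B : Matrix (Fin n) (Fin n) ℂ} {b : ℝ} {c : ℝ → Fin n → ℂ}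

theorem hasDerivAt_stableEnergy {c' : Fin n → ℂ} {t : ℝ} (hc : HasDerivAt c c' t) :
    HasDerivAt (fun t => stableEnergy M b (c t))
      (∑ i ∈ stableIndices M, (b ^ (i : ℕ)) ^ 2 * (2 * inner ℝ (c t i) (c' i))) t := by
  simp only [stableEnergy, mul_pow]
  exact HasDerivAt.fun_sum fun i _ => ((hasDerivAt_pi.1 hc i).norm_sq).const_mul _

theorem IsLyapunovWeight.antitone_stableEnergy (hb : IsLyapunovWeight M b)
    (hc : ∀ t, HasDerivAt c (M *ᵥ c t) t) : Antitone fun t => stableEnergy M b (c t) := by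
  obtain ⟨a, ha, hle⟩ := hb.dissipative
  refine antitone_of_hasDerivAt_nonpos (fun t => hasDerivAt_stableEnergy (hc t)) fun t => ?_
  refine (hle (c t)).trans ?_
  rw [neg_mul]
  exact neg_nonpos.2 (mul_nonneg ha.le (stableEnergy_nonneg _))

theorem IsLyapunovWeight.exists_antitone_exp_mul_stableEnergy (hb : IsLyapunovWeight M b)
    (hc : ∀ t, HasDerivAt c (M *ᵥ c t) t) :
    ∃ a > 0, Antitone fun t => Real.exp (a * t) * stableEnergy M b (c t) := by
  obtain ⟨a, ha, hle⟩ := hb.dissipative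
  refine ⟨a, ha, antitone_of_hasDerivAt_nonpos (fun t =>
    (((hasDerivAt_id t).const_mul a).exp).mul (hasDerivAt_stableEnergy (hc t))) fun t => ?_⟩
  have hmul := mul_le_mul_of_nonneg_left (hle (c t)) (Real.exp_pos (a * t)).le
  simp only [id, mul_one, Pi.zero_apply]
  linarith

theorem IsLyapunovWeight.tendsto_stableEnergy_zero (hb : IsLyapunovWeight M b)
    (hc : ∀ t, HasDerivAt c (M *ᵥ c t) t) :
    Tendsto (fun t => stableEnergy M b (c t)) atTop (𝓝 0) := by
  obtain ⟨a, ha, hanti⟩ := hb.exists_antitone_exp_mul_stableEnergy hc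
  have hexp : Tendsto (fun t => Real.exp (-(a * t)) * stableEnergy M b (c 0)) atTop (𝓝 0) := by
    have hlin : Tendsto (fun t => a * t) atTop atTop := tendsto_id.const_mul_atTop ha
    simpa only [zero_mul, Function.comp_def] using
      (Real.tendsto_exp_neg_atTop_nhds_zero.comp hlin).mul_const (stableEnergy M b (c 0))
  refine squeeze_zero' (Eventually.of_forall fun t => stableEnergy_nonneg _) ?_ hexp
  filter_upwards [eventually_ge_atTop 0] with t ht
  have hle := hanti ht
  simp only [mul_zero, Real.exp_zero, one_mul] at hle
  rwa [Real.exp_neg, ← div_eq_inv_mul, le_div_iff₀' (Real.exp_pos _)]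

theorem IsLyapunovWeight.tendsto_apply_zero (hb : IsLyapunovWeight M b)
    (hc : ∀ t, HasDerivAt c (M *ᵥ c t) t) {i : Fin n} (hi : (M i i).re < 0) :
    Tendsto (fun t => c t i) atTop (𝓝 0) := by
  have hsq : Tendsto (fun t => ‖c t i‖ ^ 2) atTop (𝓝 0) :=
    squeeze_zero (fun t => sq_nonneg _) (fun t => norm_sq_le_stableEnergy hb.one_le (c t) hi)
      (hb.tendsto_stableEnergy_zero hc)
  rw [tendsto_zero_iff_norm_tendsto_zero]
  simpa only [Real.sqrt_sq (norm_nonneg _), Real.sqrt_zero] using hsq.sqrt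

theorem hasDerivAt_comp_neg (hc : ∀ t, HasDerivAt c (M *ᵥ c t) t) (t : ℝ) :
    HasDerivAt (fun t => c (-t)) (-M *ᵥ c (-t)) t := by
  simpa only [Function.comp_def, neg_smul, one_smul, neg_mulVec] using
    (hc (-t)).scomp t (hasDerivAt_neg t)

theorem IsLyapunovWeight.apply_zero_eq_zero_of_tendsto (hb : IsLyapunovWeight (-M) b)
    (hc : ∀ t, HasDerivAt c (M *ᵥ c t) t) (hlim : Tendsto c atTop (𝓝 0)) {i : Fin n}
    (hi : 0 < (M i i).re) : c 0 i = 0 := by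
  have hanti := hb.antitone_stableEnergy (hasDerivAt_comp_neg hc)
  have hlimE : Tendsto (fun t => stableEnergy (-M) b (c t)) atTop (𝓝 0) :=
    stableEnergy_zero (M := -M) (b := b) ▸ (continuous_stableEnergy.tendsto 0).comp hlim
  have hE : stableEnergy (-M) b (c 0) ≤ 0 := by
    refine ge_of_tendsto hlimE ?_
    filter_upwards [eventually_ge_atTop 0] with t ht
    simpa only [neg_neg, neg_zero] using hanti (neg_nonpos.2 ht)
  have hle := norm_sq_le_stableEnergy (M := -M) hb.one_le (c 0) (i := i) (neg_neg_of_pos hi)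
  exact norm_eq_zero.1 (pow_eq_zero_iff two_ne_zero |>.1 (le_antisymm (hle.trans hE) (sq_nonneg _)))

theorem mulVec_exp_smul_mulVec_eq_zero_iff (hB : Commute B M) (r : ℂ) (v : Fin n → ℂ) :
    B *ᵥ (NormedSpace.exp (r • M) *ᵥ v) = 0 ↔ B *ᵥ v = 0 := by
  have hcomm : Commute B (NormedSpace.exp (r • M)) := (hB.smul_right r).exp_right
  rw [mulVec_mulVec, hcomm.eq, ← mulVec_mulVec]
  exact (mulVec_injective_of_isUnit (Matrix.isUnit_exp _)).eq_iff' (mulVec_zero _)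

theorem mulVec_solution_eq_zero (hB : Commute B M) (hc : ∀ t, HasDerivAt c (M *ᵥ c t) t)
    (h0 : B *ᵥ c 0 = 0) (t : ℝ) : B *ᵥ c t = 0 := by
  have hder : ∀ t, HasDerivAt (fun t => B *ᵥ c t) (M *ᵥ (B *ᵥ c t)) t := fun t => by
    rw [mulVec_mulVec, ← hB.eq, ← mulVec_mulVec]
    exact (B.mulVecLin.toContinuousLinearMap.restrictScalars
      ℝ).hasFDerivAt.comp_hasDerivAt t (hc t)
  have hzero : ∀ t : ℝ, HasDerivAt (fun _ => (0 : Fin n → ℂ)) (M *ᵥ 0) t := fun t => by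
    simpa only [mulVec_zero] using hasDerivAt_const t (0 : Fin n → ℂ)
  exact congrFun (ODE_solution_unique_univ (v := fun _ => (M *ᵥ ·)) (s := fun _ => Set.univ)
    (t₀ := 0)
    (fun _ => M.mulVecLin.toContinuousLinearMap.lipschitz.lipschitzOnWith)
    (fun t => ⟨hder t, trivial⟩) (fun t => ⟨hzero t, trivial⟩) h0) t

/-- The projection onto the coordinates whose diagonal entry in `M` has real part of sign `σ`. -/
noncomputable def spectralProj (M : Matrix (Fin n) (Fin n) ℂ) (σ : SignType) :
    Matrix (Fin n) (Fin n) ℂ :=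
  diagonal fun i => if SignType.sign (M i i).re = σ then 1 else 0

theorem spectralProj_mulVec_eq_zero_iff {σ : SignType} {v : Fin n → ℂ} :
    spectralProj M σ *ᵥ v = 0 ↔ ∀ i, SignType.sign (M i i).re = σ → v i = 0 := by
  simp [funext_iff, spectralProj, mulVec_diagonal]

theorem IsTriangularSplit.commute_spectralProj (hM : IsTriangularSplit M) (σ : SignType) :
    Commute (spectralProj M σ) M := by
  ext i j
  rw [spectralProj, diagonal_mul, mul_diagonal]
  by_cases h0 : M i j = 0
  · rw [h0, mul_zero, zero_mul]
  · rw [hM.sign_eq i j h0, mul_comm]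

theorem IsTriangularSplit.exp_smul_mulVec_eq_zero_iff (hM : IsTriangularSplit M) (σ : SignType)
    (r : ℂ) (v : Fin n → ℂ) :
    (∀ i, SignType.sign (M i i).re = σ → (NormedSpace.exp (r • M) *ᵥ v) i = 0) ↔
      ∀ i, SignType.sign (M i i).re = σ → v i = 0 := by
  simp only [← spectralProj_mulVec_eq_zero_iff]
  exact mulVec_exp_smul_mulVec_eq_zero_iff (hM.commute_spectralProj σ) r v

theorem IsTriangularSplit.solution_apply_eq_zero (hM : IsTriangularSplit M)
    (hc : ∀ t, HasDerivAt c (M *ᵥ c t) t) {σ : SignType}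
    (h0 : ∀ i, SignType.sign (M i i).re = σ → c 0 i = 0) (t : ℝ) {i : Fin n}
    (hi : SignType.sign (M i i).re = σ) : c t i = 0 :=
  spectralProj_mulVec_eq_zero_iff.1 (mulVec_solution_eq_zero (hM.commute_spectralProj σ) hc
    (spectralProj_mulVec_eq_zero_iff.2 h0) t) i hi

theorem IsTriangularSplit.tendsto_zero_iff (hM : IsTriangularSplit M)
    (hre : ∀ i, (M i i).re ≠ 0) (hc : ∀ t, HasDerivAt c (M *ᵥ c t) t) :
    Tendsto c atTop (𝓝 0) ↔ ∀ i, 0 < (M i i).re → c 0 i = 0 := by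
  obtain ⟨bs, hbs⟩ := hM.exists_isLyapunovWeight
  obtain ⟨bu, hbu⟩ := hM.neg.exists_isLyapunovWeight
  refine ⟨fun hlim i hi => hbu.apply_zero_eq_zero_of_tendsto hc hlim hi, fun h0 => ?_⟩
  refine tendsto_pi_nhds.2 fun i => ?_
  rcases (hre i).lt_or_gt with hi | hi
  · exact hbs.tendsto_apply_zero hc hi
  · refine tendsto_const_nhds.congr fun t => ?_
    exact (hM.solution_apply_eq_zero hc (fun j hj => h0 j (sign_eq_one_iff.1 hj)) t
      (sign_pos hi)).symm

end LinearSystem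

section Flow

/-- `φ` restricts to a one-parameter group of self-maps of `D`; nothing is asked of `φ` outside
`D`. -/
structure IsOneParameterGroupOn {X : Type*} (φ : ℝ → X → X) (D : Set X) : Prop where
  mapsTo : ∀ t, Set.MapsTo (φ t) D D
  apply_zero : ∀ x ∈ D, φ 0 x = x
  apply_add : ∀ x ∈ D, ∀ s t, φ (s + t) x = φ s (φ t x)

theorem IsOneParameterGroupOn.reverse {X : Type*} {φ : ℝ → X → X} {D : Set X}
    (hφ : IsOneParameterGroupOn φ D) : IsOneParameterGroupOn (fun t => φ (-t)) D where
  mapsTo t := hφ.mapsTo (-t)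
  apply_zero x hx := by rw [neg_zero, hφ.apply_zero x hx]
  apply_add x hx s t := by rw [neg_add, hφ.apply_add x hx]

theorem eq_of_hasDerivAt_of_locallyLipschitzOn {X : Type*} [NormedAddCommGroup X]
    [NormedSpace ℝ X] {D : Set X} {F : X → X} (hF : LocallyLipschitzOn D F) {f g : ℝ → X}
    (hf : ∀ t, f t ∈ D ∧ HasDerivAt f (F (f t)) t) (hg : ∀ t, g t ∈ D ∧ HasDerivAt g (F (g t)) t)
    {t₀ : ℝ} (h0 : f t₀ = g t₀) : f = g := by
  have hfc : Continuous f := continuous_iff_continuousAt.2 fun t => (hf t).2.continuousAt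
  have hgc : Continuous g := continuous_iff_continuousAt.2 fun t => (hg t).2.continuousAt
  have hwithin : ∀ {u : ℝ → X}, Continuous u → (∀ t, u t ∈ D) → ∀ t,
      Tendsto u (𝓝 t) (𝓝[D] u t) := fun hu hD t =>
    tendsto_nhdsWithin_iff.2 ⟨hu.tendsto t, Eventually.of_forall hD⟩
  have hclopen : IsClopen {t | f t = g t} := by
    refine ⟨isClosed_eq hfc hgc, isOpen_iff_mem_nhds.2 fun t (ht : f t = g t) => ?_⟩
    obtain ⟨K, U, hU, hlip⟩ := hF (hf t).1
    refine ODE_solution_unique_of_eventually (v := fun _ => F) (s := fun _ => U)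
      (Eventually.of_forall fun _ => hlip) ?_ ?_ ht
    · filter_upwards [hwithin hfc (fun t => (hf t).1) t hU] with s hs using ⟨(hf s).2, hs⟩
    · filter_upwards [hwithin hgc (fun t => (hg t).1) t (ht ▸ hU)] with s hs using ⟨(hg s).2, hs⟩
  funext t
  exact (hclopen.eq_univ ⟨t₀, h0⟩).ge (Set.mem_univ t)

theorem locallyLipschitzOn_of_contDiffOn {X Y : Type*} [NormedAddCommGroup X] [NormedSpace ℝ X]
    [NormedAddCommGroup Y] [NormedSpace ℝ Y] {D : Set X} {F : X → Y} (hD : IsOpen D)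
    (hF : ContDiffOn ℝ 1 F D) : LocallyLipschitzOn D F := fun x hx => by
  obtain ⟨K, U, hU, hlip⟩ := (hF.contDiffAt (hD.mem_nhds hx)).exists_lipschitzOnWith
  exact ⟨K, U, mem_nhdsWithin_of_mem_nhds hU, hlip⟩

variable {D : Set (E n)} {F : E n → E n} {S : ℝ → E n → E n}

theorem IsFlowOn.continuous (hS : IsFlowOn F D S) {x : E n} (hx : x ∈ D) :
    Continuous fun t => S t x :=
  continuous_iff_continuousAt.2 fun t => ((hS x hx).2 t).2.continuousAt

theorem IsFlowOn.isOneParameterGroupOn (hS : IsFlowOn F D S) (hF : LocallyLipschitzOn D F) :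
    IsOneParameterGroupOn S D where
  mapsTo t x hx := ((hS x hx).2 t).1
  apply_zero x hx := (hS x hx).1
  apply_add x hx s t := by
    have hy := ((hS x hx).2 t).1
    have heq := eq_of_hasDerivAt_of_locallyLipschitzOn hF
      (f := fun s => S (s + t) x) (g := fun s => S s (S t x)) (t₀ := 0)
      (fun s => ⟨((hS x hx).2 _).1, ((hS x hx).2 (s + t)).2.comp_add_const s t⟩)
      (fun s => (hS _ hy).2 s) (by simp only [zero_add, (hS _ hy).1])
    exact congrFun heq s

theorem IsFlowOn.apply_eq_self (hS : IsFlowOn F D S) (hF : LocallyLipschitzOn D F) {x : E n}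
    (hx : x ∈ D) (hFx : F x = 0) (t : ℝ) : S t x = x :=
  congrFun (eq_of_hasDerivAt_of_locallyLipschitzOn hF (t₀ := 0) (hS x hx).2
    (fun t => ⟨hx, hFx ▸ hasDerivAt_const t x⟩) (hS x hx).1) t

theorem linFlow_zero (F : E n → E n) : linFlow F 0 = 1 := by
  rw [linFlow, zero_smul ℝ (fderiv ℝ F 0), NormedSpace.exp_zero]

theorem exp_add_smul {𝔸 : Type*} [NormedRing 𝔸] [NormedAlgebra ℝ 𝔸] [CompleteSpace 𝔸] (s t : ℝ)
    (x : 𝔸) :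
    NormedSpace.exp ((s + t) • x) = NormedSpace.exp (s • x) * NormedSpace.exp (t • x) := by
  let _ := NormedAlgebra.restrictScalars ℚ ℝ 𝔸
  rw [add_smul, NormedSpace.exp_add_of_commute (((Commute.refl x).smul_left s).smul_right t)]

theorem linFlow_add (F : E n → E n) (s t : ℝ) : linFlow F (s + t) = linFlow F s * linFlow F t :=
  exp_add_smul s t (fderiv ℝ F 0)

theorem linFlow_neg (F : E n → E n) (t : ℝ) : linFlow (-F) t = linFlow F (-t) := by
  rw [linFlow, linFlow, fderiv_neg, smul_neg, neg_smul t (fderiv ℝ F 0)]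

theorem isOneParameterGroupOn_linFlow (F : E n → E n) :
    IsOneParameterGroupOn (fun t y => linFlow F t y) Set.univ where
  mapsTo _ := Set.mapsTo_univ _ _
  apply_zero y _ := by rw [linFlow_zero]; rfl
  apply_add y _ s t := by rw [linFlow_add]; rfl

theorem hasDerivAt_linFlow (F : E n → E n) (y : E n) (t : ℝ) :
    HasDerivAt (fun t => linFlow F t y) (fderiv ℝ F 0 (linFlow F t y)) t :=
  (ContinuousLinearMap.apply ℝ (E n) y).hasFDerivAt.comp_hasDerivAt t
    (hasDerivAt_exp_smul_const' (𝕂 := ℝ) (fderiv ℝ F 0) t)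

end Flow

section Conjugacy

variable {X Y : Type*} [TopologicalSpace X] [TopologicalSpace Y] {φ : ℝ → X → X} {ψ : ℝ → Y → Y}
  {h : OpenPartialHomeomorph X Y} {D : Set X} {D' : Set Y}

/-- The partial homeomorphism `h` carries `φ` to `ψ` for short times. Unlike in `IsLinearization`,
the two sides play the same role. -/
def IsLocalConjugacy (φ : ℝ → X → X) (ψ : ℝ → Y → Y) (h : OpenPartialHomeomorph X Y) : Prop :=
  ∀ x ∈ h.source, ∀ᶠ t in 𝓝 0, φ t x ∈ h.source ∧ h (φ t x) = ψ t (h x)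

theorem IsLocalConjugacy.symm (hc : IsLocalConjugacy φ ψ h) : IsLocalConjugacy ψ φ h.symm := by
  intro y hy
  filter_upwards [hc (h.symm y) (h.map_target hy)] with t ⟨hmem, heq⟩
  rw [h.right_inv hy] at heq
  exact heq ▸ ⟨h.map_source hmem, h.left_inv hmem⟩

theorem IsLocalConjugacy.apply_eq (hc : IsLocalConjugacy φ ψ h) (hφ : IsOneParameterGroupOn φ D)
    (hψ : IsOneParameterGroupOn ψ D') (hD' : h.target ⊆ D') {x : X} (hx : x ∈ D) {T : Set ℝ}
    (hT : T.OrdConnected) (h0 : (0 : ℝ) ∈ T) (hmem : ∀ t ∈ T, φ t x ∈ h.source) {t : ℝ}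
    (ht : t ∈ T) : h (φ t x) = ψ t (h x) := by
  have hD'mem : ∀ t ∈ T, h (φ t x) ∈ D' := fun t ht => hD' (h.map_source (hmem t ht))
  have hloc : ∀ a ∈ T, ∀ᶠ b in 𝓝[T] a, ψ (-a) (h (φ a x)) = ψ (-b) (h (φ b x)) := by
    intro a ha
    have hshift : Tendsto (fun b => b - a) (𝓝 a) (𝓝 0) :=
      (continuous_sub_right a).tendsto' a 0 (sub_self a)
    filter_upwards [nhdsWithin_le_nhds (hshift.eventually (hc _ (hmem a ha)))] with b hb
    have heq := hb.2
    rw [← hφ.apply_add x hx, sub_add_cancel] at heq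
    rw [heq, ← hψ.apply_add _ (hD'mem a ha), ← add_sub_assoc, neg_add_cancel, zero_sub]
  have hconst : ψ (-t) (h (φ t x)) = ψ (-0) (h (φ 0 x)) :=
    hT.isPreconnected.induction₂ _ hloc (fun _ _ _ _ _ _ => Eq.trans) (fun _ _ _ _ => Eq.symm) ht h0
  have hx0 : h x ∈ D' := hφ.apply_zero x hx ▸ hD'mem 0 h0
  rw [neg_zero, hφ.apply_zero x hx, hψ.apply_zero _ hx0] at hconst
  rw [← hconst, ← hψ.apply_add _ (hD'mem t ht), add_neg_cancel, hψ.apply_zero _ (hD'mem t ht)]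

theorem IsLocalConjugacy.tendsto_atTop (hc : IsLocalConjugacy φ ψ h)
    (hφ : IsOneParameterGroupOn φ D) (hψ : IsOneParameterGroupOn ψ D') (hD' : h.target ⊆ D')
    {x p : X} (hx : x ∈ D) (hp : p ∈ h.source)
    (hmem : ∀ t, 0 ≤ t → φ t x ∈ h.source) (hlim : Tendsto (fun t => φ t x) atTop (𝓝 p)) :
    Tendsto (fun t => ψ t (h x)) atTop (𝓝 (h p)) := by
  refine ((h.continuousAt hp).tendsto.comp hlim).congr' ?_
  filter_upwards [eventually_ge_atTop 0] with t ht
  exact hc.apply_eq hφ hψ hD' hx Set.ordConnected_Ici Set.self_mem_Ici hmem ht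

theorem forall_mem_of_ordConnected_of_tendsto {c : ℝ → X} {K : Set X} {p : X} {t₀ : ℝ}
    (hK : {t | c t ∈ K}.OrdConnected) (h0 : c t₀ ∈ K) (hp : K ∈ 𝓝 p)
    (hlim : Tendsto c atTop (𝓝 p)) {t : ℝ} (ht : t₀ ≤ t) : c t ∈ K := by
  obtain ⟨s, hs, hts⟩ := ((hlim.eventually_mem hp).and (eventually_ge_atTop t)).exists
  exact hK.out h0 hs ⟨ht, hts⟩

end Conjugacy

section Coordinates

variable {F : E n → E n} {V J : Matrix (Fin n) (Fin n) ℂ}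

theorem jacobian_neg (F : E n → E n) : jacobian (-F) = -jacobian F := by
  ext i j
  simp [jacobian, fderiv_neg]

theorem IsHyperbolic.neg (hF : IsHyperbolic F) : IsHyperbolic (-F) := fun μ hμ => by
  rw [jacobian_neg, ← spectrum.neg_eq, Set.mem_neg] at hμ
  simpa only [Complex.neg_re, ne_eq, neg_eq_zero] using hF _ hμ

/-- The real space `ℝⁿ` inside `ℂⁿ`. -/
noncomputable def complexify : E n →L[ℝ] (Fin n → ℂ) :=
  ContinuousLinearMap.pi fun i => Complex.ofRealCLM ∘L EuclideanSpace.proj i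

theorem complexify_injective : Function.Injective (complexify (n := n)) := fun x y hxy => by
  ext i
  exact Complex.ofReal_injective (congrFun hxy i)

theorem jacobian_mulVec_complexify (F : E n → E n) (y : E n) :
    jacobian F *ᵥ complexify y = complexify (fderiv ℝ F 0 y) := by
  ext i
  have hy : y = ∑ j, y j • EuclideanSpace.single j (1 : ℝ) := by
    ext k
    simp [Finset.sum_apply, Pi.single_apply]
  conv_rhs => rw [hy]
  simp [complexify, jacobian, mulVec, dotProduct, mul_comm]

/-- The linear coordinates `y ↦ V⁻¹ y`, so that `localEigen h V x = eigenCoord V (h x)`. -/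
noncomputable def eigenCoord (V : Matrix (Fin n) (Fin n) ℂ) : E n →L[ℝ] (Fin n → ℂ) :=
  (V⁻¹.mulVecLin.toContinuousLinearMap.restrictScalars ℝ) ∘L complexify

theorem isClosedEmbedding_eigenCoord (hV : IsUnit V.det) :
    IsClosedEmbedding (eigenCoord V) := by
  refine LinearMap.isClosedEmbedding_of_injective (f := (eigenCoord V).toLinearMap)
    (LinearMap.ker_eq_bot.2 ?_)
  exact (mulVec_injective_of_isUnit ((isUnit_nonsing_inv_iff).2
    ((isUnit_iff_isUnit_det V).2 hV))).comp complexify_injective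

/-- `V` brings `DF` at the origin to the triangular form `J`. -/
structure IsTriangularization (F : E n → E n) (V J : Matrix (Fin n) (Fin n) ℂ) : Prop where
  isUnit_det : IsUnit V.det
  conj : V⁻¹ * jacobian F * V = J
  isTriangularSplit : IsTriangularSplit J

theorem IsTriangularization.neg (hV : IsTriangularization F V J) :
    IsTriangularization (-F) V (-J) where
  isUnit_det := hV.isUnit_det
  conj := by rw [jacobian_neg, mul_neg, neg_mul, hV.conj]
  isTriangularSplit := hV.isTriangularSplit.neg

theorem diag_mem_spectrum_of_isUpperTriangular {K : Type*} [Field K] {M : Matrix (Fin n) (Fin n) K}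
    (hM : M.IsUpperTriangular) (i : Fin n) : M i i ∈ spectrum K M := by
  rw [mem_spectrum_iff_isRoot_charpoly, charpoly_of_isUpperTriangular _ hM,
    Polynomial.isRoot_prod]
  exact ⟨i, Finset.mem_univ i, by simp⟩

theorem IsTriangularization.spectrum_eq (hV : IsTriangularization F V J) :
    spectrum ℂ J = spectrum ℂ (jacobian F) := by
  obtain ⟨u, hu⟩ := (isUnit_iff_isUnit_det V).2 hV.isUnit_det
  rw [← hV.conj, ← hu, ← coe_units_inv, spectrum.units_conjugate']

theorem IsTriangularization.re_diag_ne_zero (hV : IsTriangularization F V J)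
    (hF : IsHyperbolic F) (i : Fin n) : (J i i).re ≠ 0 :=
  hF _ (hV.spectrum_eq ▸
    diag_mem_spectrum_of_isUpperTriangular hV.isTriangularSplit.isUpperTriangular i)

theorem IsTriangularization.eigenCoord_fderiv (hV : IsTriangularization F V J) (y : E n) :
    eigenCoord V (fderiv ℝ F 0 y) = J *ᵥ eigenCoord V y := by
  change V⁻¹ *ᵥ complexify (fderiv ℝ F 0 y) = J *ᵥ (V⁻¹ *ᵥ complexify y)
  rw [← jacobian_mulVec_complexify, mulVec_mulVec, mulVec_mulVec, ← hV.conj, mul_assoc _ V,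
    mul_nonsing_inv V hV.isUnit_det, mul_one]

theorem IsTriangularization.hasDerivAt_eigenCoord_linFlow (hV : IsTriangularization F V J)
    (y : E n) (t : ℝ) :
    HasDerivAt (fun t => eigenCoord V (linFlow F t y)) (J *ᵥ eigenCoord V (linFlow F t y)) t :=
  hV.eigenCoord_fderiv (linFlow F t y) ▸
    (eigenCoord V).hasFDerivAt.comp_hasDerivAt t (hasDerivAt_linFlow F y t)

theorem IsTriangularization.tendsto_linFlow_zero_iff (hV : IsTriangularization F V J)
    (hF : IsHyperbolic F) (y : E n) :
    Tendsto (fun t => linFlow F t y) atTop (𝓝 0) ↔ ∀ i, 0 < (J i i).re → eigenCoord V y i = 0 := by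
  have hlin := hV.isTriangularSplit.tendsto_zero_iff (hV.re_diag_ne_zero hF)
    (hV.hasDerivAt_eigenCoord_linFlow y)
  rw [linFlow_zero] at hlin
  rw [(isClosedEmbedding_eigenCoord hV.isUnit_det).isInducing.tendsto_nhds_iff, map_zero]
  exact hlin

theorem IsHyperbolic.eq_zero_of_linFlow_eventuallyEq (hF : IsHyperbolic F) {y : E n}
    (hy : ∀ᶠ t in 𝓝 0, linFlow F t y = y) : y = 0 := by
  have hder : fderiv ℝ F 0 y = 0 := by
    have hconst : HasDerivAt (fun t => linFlow F t y) 0 0 :=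
      (hasDerivAt_const 0 y).congr_of_eventuallyEq hy
    simpa only [linFlow_zero, one_apply_eq_self] using
      (hasDerivAt_linFlow F y 0).unique hconst
  have hunit : IsUnit (jacobian F) := by
    by_contra hu
    exact hF 0 (spectrum.zero_mem ℂ hu) rfl
  apply complexify_injective
  apply mulVec_injective_of_isUnit hunit
  rw [jacobian_mulVec_complexify, hder, map_zero, mulVec_zero]

end Coordinates

section Linearization

variable {F : E n → E n} {D N : Set (E n)} {S : ℝ → E n → E n}
  {h : OpenPartialHomeomorph (E n) (E n)}

theorem IsLinearization.isLocalConjugacy (hh : IsLinearization F D S h) :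
    IsLocalConjugacy S (fun t y => linFlow F t y) h := fun x hx => by
  obtain ⟨I, hIo, -, hI0, hI⟩ := hh.conj x hx
  exact eventually_of_mem (hIo.mem_nhds hI0) hI

theorem IsLinearization.neg (hh : IsLinearization F D S h) :
    IsLinearization (-F) D (fun t => S (-t)) h where
  zero_mem := hh.zero_mem
  source_subset := hh.source_subset
  conj x hx := by
    obtain ⟨I, hIo, hIc, hI0, hI⟩ := hh.conj x hx
    refine ⟨Neg.neg ⁻¹' I, hIo.preimage continuous_neg, hIc.preimage_anti fun _ _ => neg_le_neg, ?_,
      fun t ht => ?_⟩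
    · rwa [Set.mem_preimage, neg_zero]
    · rw [linFlow_neg]
      exact hI (-t) ht

theorem IsAdmissible.neg (hN : IsAdmissible F h N) : IsAdmissible (-F) h N where
  isOpen := hN.isOpen
  isConnected := hN.isConnected
  zero_mem := hN.zero_mem
  closure_subset := hN.closure_subset
  ordConnected y hy := by
    simp only [linFlow_neg]
    exact (hN.ordConnected y hy).preimage_anti fun _ _ => neg_le_neg

theorem IsLinearization.apply_zero (hh : IsLinearization F D S h) (hF : IsHyperbolic F)
    (hS0 : ∀ t, S t 0 = 0) : h 0 = 0 := by
  refine hF.eq_zero_of_linFlow_eventuallyEq ?_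
  filter_upwards [hh.isLocalConjugacy 0 hh.zero_mem] with t ht
  rw [← ht.2, hS0]

theorem IsAdmissible.tendsto_linFlow_iff_mem_localStable (hN : IsAdmissible F h N)
    (hh : IsLinearization F D S h) (hh0 : h 0 = 0) (hS : IsOneParameterGroupOn S D) {x : E n}
    (hx : x ∈ closure N) :
    Tendsto (fun t => linFlow F t (h x)) atTop (𝓝 0) ↔ x ∈ localStable S (closure N) := by
  have hxs : x ∈ h.source := hN.closure_subset hx
  have hL := isOneParameterGroupOn_linFlow F
  constructor
  · intro hlim
    have hnhds : h '' closure N ∈ 𝓝 (0 : E n) := by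
      rw [← hh0]
      exact h.image_mem_nhds hh.zero_mem
        (mem_of_superset (hN.isOpen.mem_nhds hN.zero_mem) subset_closure)
    have hmem : ∀ t, 0 ≤ t → linFlow F t (h x) ∈ h '' closure N := fun t ht =>
      forall_mem_of_ordConnected_of_tendsto (hN.ordConnected _ (Set.mem_image_of_mem h hx))
        (by rw [linFlow_zero]; exact Set.mem_image_of_mem h hx) hnhds hlim ht
    have htarget : ∀ t, 0 ≤ t → linFlow F t (h x) ∈ h.target := fun t ht =>
      h.mapsTo.image_subset (Set.image_mono hN.closure_subset (hmem t ht))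
    have hsymm : IsLocalConjugacy _ S h.symm := hh.isLocalConjugacy.symm
    refine ⟨fun t ht => ?_, ?_⟩
    · have heq : h.symm (linFlow F t (h x)) = S t (h.symm (h x)) :=
        hsymm.apply_eq hL hS hh.source_subset (Set.mem_univ _) Set.ordConnected_Ici
          Set.self_mem_Ici htarget ht
      obtain ⟨y, hy, hye⟩ := hmem t ht
      rw [h.left_inv hxs, ← hye, h.left_inv (hN.closure_subset hy)] at heq
      exact heq ▸ hy
    · have hlimS := hsymm.tendsto_atTop hL hS hh.source_subset (Set.mem_univ (h x))
        (hh0 ▸ h.map_source hh.zero_mem) htarget hlim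
      rwa [← hh0, h.left_inv hh.zero_mem, h.left_inv hxs] at hlimS
  · rintro ⟨hmem, hlim⟩
    have hlimL := hh.isLocalConjugacy.tendsto_atTop hS hL (Set.subset_univ _)
      (hh.source_subset hxs) hh.zero_mem (fun t ht => hN.closure_subset (hmem t ht)) hlim
    rwa [hh0] at hlimL

end Linearization

section Homogeneous

variable {X : Type*} [AddCommGroup X] [Module ℝ X] {g : X → ℝ} {ε r : ℝ} {x : X}

theorem apply_smul_lt_of_homogeneous (hg : ∀ (r : ℝ) x, g (r • x) = r ^ 2 * g x) (hε : 0 < ε)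
    (hr0 : 0 ≤ r) (hr1 : r < 1) (hx : g x ≤ ε) : g (r • x) < ε :=
  calc g (r • x) = r ^ 2 * g x := hg r x
    _ ≤ r ^ 2 * ε := by gcongr
    _ < ε := mul_lt_of_lt_one_left hε (pow_lt_one₀ hr0 hr1 two_ne_zero)

variable [TopologicalSpace X] [ContinuousSMul ℝ X]

theorem isConnected_sublevel_of_homogeneous [ContinuousAdd X]
    (hg : ∀ (r : ℝ) x, g (r • x) = r ^ 2 * g x) (hε : 0 < ε) : IsConnected {x | g x < ε} := by
  have h0 : g 0 = 0 := by simpa only [zero_smul, sq, zero_mul] using hg 0 0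
  suffices hstar : StarConvex ℝ 0 {x | g x < ε} from
    (hstar.isPathConnected (h0.trans_lt hε)).isConnected
  refine starConvex_zero_iff.2 fun x hx r hr0 hr1 => ?_
  rcases hr1.lt_or_eq with hr1 | rfl
  · exact apply_smul_lt_of_homogeneous hg hε hr0 hr1 (le_of_lt hx)
  · rwa [one_smul]

theorem sublevel_subset_closure_of_homogeneous (hg : ∀ (r : ℝ) x, g (r • x) = r ^ 2 * g x)
    (hε : 0 < ε) : {x | g x ≤ ε} ⊆ closure {x | g x < ε} := fun x hx => by
  have hlim : Tendsto (fun r : ℝ => r • x) (𝓝[<] 1) (𝓝 x) := by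
    simpa only [one_smul, id] using (tendsto_id.smul_const x).mono_left
      (nhdsWithin_le_nhds (a := (1 : ℝ)) (s := Set.Iio 1))
  refine mem_closure_of_tendsto hlim ?_
  filter_upwards [Ico_mem_nhdsLT one_pos] with r hr
  exact apply_smul_lt_of_homogeneous hg hε hr.1 hr.2 hx

end Homogeneous

section IsolatingBlock

variable {M : Matrix (Fin n) (Fin n) ℂ} {b b' : ℝ} {c : ℝ → Fin n → ℂ}

/-- The larger of the Lyapunov functions of `z' = M z` forward and backward in time. Its sublevel
sets are isolating blocks: every solution meets them in an interval of times. -/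
noncomputable def blockEnergy (M : Matrix (Fin n) (Fin n) ℂ) (b b' : ℝ) (z : Fin n → ℂ) : ℝ :=
  max (stableEnergy M b z) (stableEnergy (-M) b' z)

theorem blockEnergy_zero : blockEnergy M b b' 0 = 0 := by
  rw [blockEnergy, stableEnergy_zero, stableEnergy_zero, max_self]

theorem blockEnergy_smul (r : ℝ) (z : Fin n → ℂ) :
    blockEnergy M b b' (r • z) = r ^ 2 * blockEnergy M b b' z := by
  rw [blockEnergy, stableEnergy_smul, stableEnergy_smul, blockEnergy,
    mul_max_of_nonneg _ _ (sq_nonneg r)]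

theorem continuous_blockEnergy : Continuous (blockEnergy M b b') :=
  continuous_stableEnergy.max continuous_stableEnergy

theorem norm_le_of_blockEnergy_le (hM : ∀ i, (M i i).re ≠ 0) (hb : 1 ≤ b) (hb' : 1 ≤ b')
    {z : Fin n → ℂ} {r : ℝ} (hr : 0 ≤ r) (hz : blockEnergy M b b' z ≤ r ^ 2) : ‖z‖ ≤ r := by
  obtain ⟨hle, hle'⟩ := max_le_iff.1 hz
  refine (pi_norm_le_iff_of_nonneg hr).2 fun i => (sq_le_sq₀ (norm_nonneg _) hr).1 ?_
  rcases lt_or_gt_of_ne (hM i) with hi | hi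
  · exact (norm_sq_le_stableEnergy hb z hi).trans hle
  · exact (norm_sq_le_stableEnergy (M := -M) hb' z (neg_neg_of_pos hi)).trans hle'

theorem isCompact_blockEnergy_le (hM : ∀ i, (M i i).re ≠ 0) (hb : 1 ≤ b) (hb' : 1 ≤ b') {r : ℝ}
    (hr : 0 ≤ r) : IsCompact {z | blockEnergy M b b' z ≤ r ^ 2} :=
  (isCompact_closedBall 0 r).of_isClosed_subset
    (isClosed_le continuous_blockEnergy continuous_const) fun _ hz =>
    mem_closedBall_zero_iff.2 (norm_le_of_blockEnergy_le hM hb hb' hr hz)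

theorem ordConnected_blockEnergy_le (hb : IsLyapunovWeight M b) (hb' : IsLyapunovWeight (-M) b')
    (hc : ∀ t, HasDerivAt c (M *ᵥ c t) t) (ε : ℝ) :
    {t | blockEnergy M b b' (c t) ≤ ε}.OrdConnected := by
  have hmono : Monotone fun t => stableEnergy (-M) b' (c t) := fun s t hst => by
    simpa only [neg_neg] using
      hb'.antitone_stableEnergy (hasDerivAt_comp_neg hc) (neg_le_neg hst)
  simp only [blockEnergy, max_le_iff]
  exact (Set.ordConnected_Iic.preimage_anti (hb.antitone_stableEnergy hc)).inter
    (Set.ordConnected_Iic.preimage_mono hmono)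

end IsolatingBlock

section Admissible

variable {F : E n → E n} {V J : Matrix (Fin n) (Fin n) ℂ} {h : OpenPartialHomeomorph (E n) (E n)}

theorem closure_image_eq_of_isCompact {X Y : Type*} [TopologicalSpace X] [TopologicalSpace Y]
    [T2Space Y] {f : X → Y} {B C : Set X} (hf : ContinuousOn f C) (hC : IsCompact C)
    (hBC : B ⊆ C) (hCB : C ⊆ closure B) : closure (f '' B) = f '' C := by
  refine (closure_minimal (Set.image_mono hBC) (hC.image_of_continuousOn hf).isClosed).antisymm ?_
  rintro _ ⟨x, hx, rfl⟩
  exact ((hf x hx).mono hBC).mem_closure_image (hCB hx)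

theorem isAdmissible_symm_image {B C : Set (E n)} (h0 : h.symm 0 = 0) (hBo : IsOpen B)
    (hBc : IsConnected B) (hB0 : 0 ∈ B) (hC : IsCompact C) (hBC : B ⊆ C) (hCB : C ⊆ closure B)
    (hCh : C ⊆ h.target) (hord : ∀ y ∈ C, {t : ℝ | linFlow F t y ∈ C}.OrdConnected) :
    IsAdmissible F h (h.symm '' B) := by
  have hcont : ContinuousOn h.symm C := h.continuousOn_symm.mono hCh
  have hclosure : closure (h.symm '' B) = h.symm '' C :=
    closure_image_eq_of_isCompact hcont hC hBC hCB
  have himage : h '' (h.symm '' C) = C := h.toPartialEquiv.image_symm_image_of_subset_target hCh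
  refine ⟨h.symm.isOpen_image_of_subset_source hBo (hBC.trans hCh),
    hBc.image _ (hcont.mono hBC), ⟨0, hB0, h0⟩, ?_, ?_⟩
  · exact hclosure ▸ h.symm.mapsTo.image_subset.trans' (Set.image_mono hCh)
  · rwa [hclosure, himage]

theorem IsTriangularization.exists_blockEnergy_le_subset (hV : IsTriangularization F V J)
    (hF : IsHyperbolic F) {b b' : ℝ} (hb : 1 ≤ b) (hb' : 1 ≤ b') {U : Set (E n)} (hU : U ∈ 𝓝 0) :
    ∃ r > 0, {y | blockEnergy J b b' (eigenCoord V y) ≤ r ^ 2} ⊆ U := by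
  rw [(isClosedEmbedding_eigenCoord hV.isUnit_det).isInducing.nhds_eq_comap, map_zero] at hU
  obtain ⟨r, hr, hball⟩ := (Metric.nhds_basis_closedBall.comap _).mem_iff.1 hU
  exact ⟨r, hr, fun y hy => hball (mem_closedBall_zero_iff.2
    (norm_le_of_blockEnergy_le (hV.re_diag_ne_zero hF) hb hb' (le_of_lt hr) hy))⟩

theorem IsTriangularization.exists_isAdmissible (hV : IsTriangularization F V J)
    (hF : IsHyperbolic F) (h0 : 0 ∈ h.source) (hh0 : h 0 = 0) {O : Set (E n)} (hO : O ∈ 𝓝 0) :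
    ∃ N ⊆ O, IsAdmissible F h N := by
  have h0t : (0 : E n) ∈ h.target := hh0 ▸ h.map_source h0
  have hsymm0 : h.symm 0 = 0 := by simpa only [hh0] using h.left_inv h0
  have hU : h.target ∩ h.symm ⁻¹' O ∈ 𝓝 0 :=
    inter_mem (h.open_target.mem_nhds h0t)
      ((h.continuousAt_symm h0t).preimage_mem_nhds (by rwa [hsymm0]))
  obtain ⟨b, hb⟩ := hV.isTriangularSplit.exists_isLyapunovWeight
  obtain ⟨b', hb'⟩ := hV.isTriangularSplit.neg.exists_isLyapunovWeight
  obtain ⟨r, hr, hsub⟩ := hV.exists_blockEnergy_le_subset hF hb.one_le hb'.one_le hU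
  set g : E n → ℝ := fun y => blockEnergy J b b' (eigenCoord V y) with hg_def
  have hg : Continuous g := continuous_blockEnergy.comp (eigenCoord V).continuous
  have hghom : ∀ (r : ℝ) y, g (r • y) = r ^ 2 * g y := fun r y => by
    simp only [hg_def, map_smul, blockEnergy_smul]
  have hg0 : g 0 = 0 := by simp only [hg_def, map_zero, blockEnergy_zero]
  have hr2 : 0 < r ^ 2 := pow_pos hr 2
  have hlt : {y | g y < r ^ 2} ⊆ {y | g y ≤ r ^ 2} := Set.ofPred_subset_ofPred.2 fun _ => le_of_lt
  have hcompact : IsCompact {y | g y ≤ r ^ 2} :=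
    (isClosedEmbedding_eigenCoord hV.isUnit_det).isCompact_preimage
      (isCompact_blockEnergy_le (hV.re_diag_ne_zero hF) hb.one_le hb'.one_le hr.le)
  exact ⟨h.symm '' {y | g y < r ^ 2}, Set.image_subset_iff.2 fun y hy => (hsub (hlt hy)).2,
    isAdmissible_symm_image hsymm0 (isOpen_lt hg continuous_const)
      (isConnected_sublevel_of_homogeneous hghom hr2) (hg0.trans_lt hr2) hcompact hlt
      (sublevel_subset_closure_of_homogeneous hghom hr2) (fun y hy => (hsub hy).1)
      fun y _ => ordConnected_blockEnergy_le hb hb' (hV.hasDerivAt_eigenCoord_linFlow y) _⟩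

end Admissible

section PrincipalPart

variable {D K N : Set (E n)} {F : E n → E n} {S : ℝ → E n → E n} {z : E n}
  {J V : Matrix (Fin n) (Fin n) ℂ} {h : OpenPartialHomeomorph (E n) (E n)}

theorem apply_entryTime_mem (hc : Continuous fun t => S t z) (hz : ∃ t, S t z ∈ closure N) :
    S (entryTime S N z) z ∈ closure N := by
  have hclosed : IsClosed {t | S t z ∈ closure N} := isClosed_closure.preimage hc
  rw [entryTime]
  split_ifs with hpos
  · exact ((isClosed_Ici.inter hclosed).csInf_mem hpos ⟨0, fun _ ht => ht.1⟩).2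
  · obtain ⟨t, ht⟩ := hz
    have hneg : t ≤ 0 := le_of_not_ge fun h0 => hpos ⟨t, h0, ht⟩
    exact ((isClosed_Iic.inter hclosed).csSup_mem ⟨t, hneg, ht⟩ ⟨0, fun _ ht => ht.1⟩).2

theorem IsOneParameterGroupOn.apply_mem_domainP (hS : IsOneParameterGroupOn S D)
    (hz : z ∈ domainP S D N) (τ : ℝ) : S τ z ∈ domainP S D N := by
  obtain ⟨hzD, t, ht⟩ := hz
  exact ⟨hS.mapsTo τ hzD, t - τ, by rwa [← hS.apply_add z hzD, sub_add_cancel]⟩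

theorem IsOneParameterGroupOn.tendsto_of_tendsto_apply {X : Type*} {φ : ℝ → X → X} {A : Set X}
    (hφ : IsOneParameterGroupOn φ A) {x : X} (hx : x ∈ A) {τ : ℝ} {l : Filter ℝ} {l' : Filter X}
    (hl : Tendsto (fun t => t - τ) l l) (hlim : Tendsto (fun t => φ t (φ τ x)) l l') :
    Tendsto (fun t => φ t x) l l' :=
  (hlim.comp hl).congr fun t => by
    rw [Function.comp_apply, ← hφ.apply_add x hx, sub_add_cancel]

theorem IsOneParameterGroupOn.mem_principalStable_iff (hS : IsOneParameterGroupOn S D) :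
    z ∈ principalStable S D N ↔
      z ∈ domainP S D N ∧ S (entryTime S N z) z ∈ localStable S (closure N) :=
  and_congr_right fun hz => and_iff_right_of_imp fun hloc => ⟨hz.1,
    hS.tendsto_of_tendsto_apply hz.1 (tendsto_atTop_add_const_right _ _ tendsto_id) hloc.2⟩

theorem IsOneParameterGroupOn.mem_principalUnstable_iff (hS : IsOneParameterGroupOn S D) :
    z ∈ principalUnstable S D N ↔
      z ∈ domainP S D N ∧ S (entryTime S N z) z ∈ localUnstable S (closure N) :=
  and_congr_right fun hz => and_iff_right_of_imp fun hloc => ⟨hz.1,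
    hS.tendsto_of_tendsto_apply hz.1 (tendsto_atBot_add_const_right _ _ tendsto_id) hloc.2⟩

theorem localStable_comp_neg : localStable (fun t => S (-t)) K = localUnstable S K := by
  ext x
  refine and_congr ⟨fun hmem t ht => ?_, fun hmem t ht => hmem (-t) (neg_nonpos.2 ht)⟩
    ⟨fun hlim => ?_, fun hlim => hlim.comp tendsto_neg_atTop_atBot⟩
  · simpa only [neg_neg] using hmem (-t) (neg_nonneg.2 ht)
  · simpa only [Function.comp_def, neg_neg] using hlim.comp tendsto_neg_atBot_atTop

theorem IsFlowExtension.apply_eq_zero_iff {k s : E n → Fin n → ℂ}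
    (hs : IsFlowExtension S D N J k s) (hJ : IsTriangularSplit J) (hz : z ∈ domainP S D N)
    (σ : SignType) :
    (∀ i, SignType.sign (J i i).re = σ → s z i = 0) ↔
      ∀ i, SignType.sign (J i i).re = σ → k (S (entryTime S N z) z) i = 0 := by
  rw [hs z hz]
  exact hJ.exp_smul_mulVec_eq_zero_iff σ _ _

theorem IsOpenEigenfamily.apply_eq_zero_iff {s : E n → Fin n → ℂ}
    (hs : IsOpenEigenfamily S K J s) (hJ : IsTriangularSplit J) (hz : ∀ t, S t z ∈ K) (hzK : z ∈ K)
    (σ : SignType) (τ : ℝ) :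
    (∀ i, SignType.sign (J i i).re = σ → s z i = 0) ↔
      ∀ i, SignType.sign (J i i).re = σ → s (S τ z) i = 0 := by
  rw [hs z hzK Set.univ isOpen_univ Set.ordConnected_univ trivial (fun t _ => hz t) τ trivial]
  exact (hJ.exp_smul_mulVec_eq_zero_iff σ _ _).symm

theorem IsAdmissible.localEigen_eq_zero_iff_mem_localStable (hN : IsAdmissible F h N)
    (hh : IsLinearization F D S h) (hh0 : h 0 = 0) (hS : IsOneParameterGroupOn S D)
    (hF : IsHyperbolic F) (hV : IsTriangularization F V J) (hz : z ∈ closure N) :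
    (∀ i, 0 < (J i i).re → localEigen h V z i = 0) ↔ z ∈ localStable S (closure N) :=
  (hV.tendsto_linFlow_zero_iff hF (h z)).symm.trans
    (hN.tendsto_linFlow_iff_mem_localStable hh hh0 hS hz)

theorem IsAdmissible.localEigen_eq_zero_iff_mem_localUnstable (hN : IsAdmissible F h N)
    (hh : IsLinearization F D S h) (hh0 : h 0 = 0) (hS : IsOneParameterGroupOn S D)
    (hF : IsHyperbolic F) (hV : IsTriangularization F V J) (hz : z ∈ closure N) :
    (∀ i, (J i i).re < 0 → localEigen h V z i = 0) ↔ z ∈ localUnstable S (closure N) := by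
  have hrev := hN.neg.localEigen_eq_zero_iff_mem_localStable hh.neg hh0 hS.reverse hF.neg hV.neg hz
  simpa only [localStable_comp_neg, Matrix.neg_apply, Complex.neg_re, neg_pos] using hrev

end PrincipalPart

end Koopman

theorem mainTheorem8_general {n : ℕ} (D : Set (Koopman.E n)) (F : Koopman.E n → Koopman.E n)
    (hF : LocallyLipschitzOn D F) (hF0 : F 0 = 0) (hhyp : Koopman.IsHyperbolic F)
    (S : ℝ → Koopman.E n → Koopman.E n) (hS : Koopman.IsFlowOn F D S)
    (h : OpenPartialHomeomorph (Koopman.E n) (Koopman.E n))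
    (hh : Koopman.IsLinearization F D S h)
    (V J : Matrix (Fin n) (Fin n) ℂ) (hV : IsUnit V.det) (hJ : Koopman.IsTriangularSplit J)
    (hVJ : V⁻¹ * Koopman.jacobian F * V = J) :
    (∀ O ∈ nhds (0 : Koopman.E n), ∃ N ⊆ O, Koopman.IsAdmissible F h N) ∧
    ∀ N : Set (Koopman.E n), Koopman.IsAdmissible F h N →
      ∀ s : Koopman.E n → Fin n → ℂ,
        (Koopman.IsFlowExtension S D N J (Koopman.localEigen h V) s ∨
          (Koopman.IsOpenEigenfamily S (Koopman.domainP S D N) J s ∧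
            Set.EqOn s (Koopman.localEigen h V) (closure N))) →
        {x | x ∈ Koopman.domainP S D N ∧ ∀ i, 0 < (J i i).re → s x i = 0}
            = Koopman.principalStable S D N ∧
        {x | x ∈ Koopman.domainP S D N ∧ ∀ i, (J i i).re < 0 → s x i = 0}
            = Koopman.principalUnstable S D N := by
  have hgroup := hS.isOneParameterGroupOn hF
  have htri : Koopman.IsTriangularization F V J := ⟨hV, hVJ, hJ⟩
  have hh0 : h 0 = 0 :=
    hh.apply_zero hhyp (hS.apply_eq_self hF (hh.source_subset hh.zero_mem) hF0)
  refine ⟨fun O hO => htri.exists_isAdmissible hhyp hh.zero_mem hh0 hO, fun N hN s hs => ?_⟩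
  have hentry : ∀ z ∈ Koopman.domainP S D N, S (Koopman.entryTime S N z) z ∈ closure N :=
    fun z hz => Koopman.apply_entryTime_mem (hS.continuous hz.1) hz.2
  have hzero : ∀ z ∈ Koopman.domainP S D N, ∀ σ : SignType,
      (∀ i, SignType.sign (J i i).re = σ → s z i = 0) ↔ ∀ i, SignType.sign (J i i).re = σ →
        Koopman.localEigen h V (S (Koopman.entryTime S N z) z) i = 0 := fun z hz σ => by
    rcases hs with hs | ⟨hs, hsk⟩
    · exact hs.apply_eq_zero_iff hJ hz σ
    · rw [← hsk (hentry z hz)]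
      exact hs.apply_eq_zero_iff hJ (hgroup.apply_mem_domainP hz) hz σ _
  constructor <;> ext z
  · refine Iff.trans (and_congr_right fun hz => ?_) hgroup.mem_principalStable_iff.symm
    rw [← hN.localEigen_eq_zero_iff_mem_localStable hh hh0 hgroup hhyp htri (hentry z hz)]
    simpa only [sign_eq_one_iff] using hzero z hz 1
  · refine Iff.trans (and_congr_right fun hz => ?_) hgroup.mem_principalUnstable_iff.symm
    rw [← hN.localEigen_eq_zero_iff_mem_localUnstable hh hh0 hgroup hhyp htri (hentry z hz)]
    simpa only [sign_eq_neg_one_iff] using hzero z hz (-1)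

theorem mainTheorem8 {n : ℕ} (D : Set (Koopman.E n)) (hD : IsOpen D) (h0 : (0 : Koopman.E n) ∈ D)
    (F : Koopman.E n → Koopman.E n) (hF : ContDiffOn ℝ 2 F D) (hF0 : F 0 = 0)
    (hhyp : Koopman.IsHyperbolic F)
    (S : ℝ → Koopman.E n → Koopman.E n) (hS : Koopman.IsFlowOn F D S)
    (h : OpenPartialHomeomorph (Koopman.E n) (Koopman.E n))
    (hh : Koopman.IsLinearization F D S h)
    (V J : Matrix (Fin n) (Fin n) ℂ) (hV : IsUnit V.det) (hJ : Koopman.IsJordan J)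
    (hVJ : V⁻¹ * Koopman.jacobian F * V = J) :
    (∀ O ∈ nhds (0 : Koopman.E n), ∃ N ⊆ O, Koopman.IsAdmissible F h N) ∧
    ∀ N : Set (Koopman.E n), Koopman.IsAdmissible F h N →
      ∀ s : Koopman.E n → Fin n → ℂ,
        (Koopman.IsFlowExtension S D N J (Koopman.localEigen h V) s ∨
          (Koopman.IsOpenEigenfamily S (Koopman.domainP S D N) J s ∧
            Set.EqOn s (Koopman.localEigen h V) (closure N))) →
        {x | x ∈ Koopman.domainP S D N ∧ ∀ i, 0 < (J i i).re → s x i = 0}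
            = Koopman.principalStable S D N ∧
        {x | x ∈ Koopman.domainP S D N ∧ ∀ i, (J i i).re < 0 → s x i = 0}
            = Koopman.principalUnstable S D N :=
  mainTheorem8_general D F (Koopman.locallyLipschitzOn_of_contDiffOn hD
    (hF.of_le one_le_two)) hF0 hhyp S hS h hh V J hV hJ.isTriangularSplit hVJ
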